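/- **Setting.** Let $G=(V,E,w)$ be an undirected graph on $n$ vertices with positive integer edge weights, subject to a fixed (oblivious) sequence of updates, each of which deletes an edge or increases the weight of an edge. Let $G_t$ be the graph after the first $t$ updates and $d_t$ its shortest path distance ($\infty$ between different components), and put $d_t(u,S)=\min_{a\in S}d_t(u,a)$, with $d_t(u,\emptyset)=\infty$. Let $k\ge 1$ be an integer, $\rho>0$, $\nu=\frac{1}{2^k-1}$, $L=k+\lceil 1/\rho\rceil+1$ and $q_i=\max(n^{-2^i\nu},n^{-\rho})$. Let $V=A_0\supseteq A_1\supseteq\dots\supseteq A_L=\emptyset$ be random sets, chosen once and independently of the updates: for $0\le i<L-1$, every element of $A_i$ is kept in $A_{i+1}$ with probability $q_i$, all choices being independent (and $A_i=\emptyset$ for all $i\ge L$). For an integer depth $d\ge 1$ and $w\in A_i\setminus A_{i+1}$, the cluster of $w$ up to depth $d$ at time $t$ is $$C_t(w)=\{u\in V:\ d_t(u,w)<d_t(u,A_{i+1})\ \text{and}\ d_t(u,w)\le d\}.$$ **Algorithm.** For a fixed $i$, one depth-bounded Even–Shiloach tree maintains the distances up to $d$ to $A_{i+1}$, and every $w\in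 A_i$ has a tree of its own, rooted at $w$. A tree stores the levels of its vertices and, at each vertex $y$, a heap that contains, for each neighbour $x$ of $y$ in the tree, the level of $x$ plus the weight of the edge $xy$. The radius of a tree at $v$ is $d+1$ for the tree of $A_{i+1}$, and for the trees of $A_i$ it is the minimum of $d+1$ and the maintained distance from $v$ to $A_{i+1}$. After an update, a tree renews the keys of the updated edge, takes out, one at a time, vertices whose level is smaller than the minimum of their heap, and then runs a modified Dijkstra algorithm, in which, repeatedly, a vertex outside the tree of least key joins, among those whose key is below their radius (a root has key $0$). Initially only the Dijkstra algorithm is run, from the empty tree. Whenever a vertex $v$ is taken out of a tree or joins it, the edges incident on $v$ are scanned in this tree, to update the heaps of the neighbours of $v$; nothing else reads the adjacency list of $v$. **Lemma.** There is an absolute constant $C>0$ such that, for all such $G$, update sequences, $k$, $\rho$, $d$ and all $0\le i\le L$, this algorithm has the following two properties. 1. It maintains the clusters up to depth $d$: for every outcome of the sampling, every time $t$ (including $t=0$) and every $w\in A_i\setminus A_{i+1}$, the vertices in the tree of $w$ at time $t$ are exactly those of $C_t(w)$, and the level of each $v\in C_t(w)$ is $d_t(v,w)$. 2. For every $v\in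 V$, the expected total number of times that the edges incident on $v$ are scanned, over the initialisation and the whole sequence of updates and over the trees of all $w\in A_i$, is at most $C\,d/q_i$. -/

import Mathlib

open MeasureTheory ProbabilityTheory
open scoped ENNReal

namespace DecrementalClusters

/-! ### Weighted graphs under edge deletions and weight increases -/

/-- A weighted undirected graph on `n` vertices with positive integer edge weights. -/
structure WGraph (n : ℕ) where
  graph : SimpleGraph (Fin n)
  weight : Sym2 (Fin n) → ℕ
  weight_pos : ∀ e ∈ graph.edgeSet, 0 < weight e

/-- The decremental updates: deleting an edge, or increasing its weight by `δ`. -/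
inductive Update (n : ℕ) where
  | delete (e : Sym2 (Fin n)) : Update n
  | increase (e : Sym2 (Fin n)) (δ : ℕ) : Update n

/-- The edge that an update touches. -/
def Update.edge {n : ℕ} : Update n → Sym2 (Fin n)
  | .delete e => e
  | .increase e _ => e

namespace WGraph

variable {n : ℕ}

/-- The graph after one update. -/
def apply (G : WGraph n) : Update n → WGraph n
  | .delete e =>
    { graph := G.graph.deleteEdges {e}
      weight := G.weight
      weight_pos := fun f hf => G.weight_pos f (by
        rw [SimpleGraph.edgeSet_deleteEdges] at hf
        exact hf.1) }
  | .increase e δ =>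
    { graph := G.graph
      weight := Function.update G.weight e (G.weight e + δ)
      weight_pos := fun f hf => by
        by_cases h : f = e
        · subst h
          simpa using Nat.add_pos_left (G.weight_pos f hf) δ
        · simpa [Function.update_of_ne h] using G.weight_pos f hf }

/-- The graph after a sequence of updates. -/
def applyAll (G : WGraph n) (us : List (Update n)) : WGraph n := us.foldl apply G

open Classical in
/-- The weight of the edge between `x` and `y`, which is `⊤` if there is no such edge. -/
noncomputable def len (G : WGraph n) (x y : Fin n) : ℕ∞ :=
  if G.graph.Adj x y then (G.weight s(x, y) : ℕ∞) else ⊤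

/-- Weighted shortest path distance, which is `⊤` between different components. -/
noncomputable def dist (G : WGraph n) (u v : Fin n) : ℕ∞ :=
  ⨅ p : G.graph.Walk u v, (((p.edges.map G.weight).sum : ℕ) : ℕ∞)

/-- The distance from `u` to a set of vertices, which is `⊤` for the empty set. -/
noncomputable def distSet (G : WGraph n) (u : Fin n) (S : Finset (Fin n)) : ℕ∞ :=
  ⨅ a ∈ S, G.dist u a

/-- The cluster of a center `w ∈ A_i \ A_{i+1}`, where `Anext = A_{i+1}`. -/
def cluster (G : WGraph n) (Anext : Finset (Fin n)) (w : Fin n) : Set (Fin n) :=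
  {u | G.dist u w < G.distSet u Anext}

/-- The cluster of `w` up to depth `d`. -/
def boundedCluster (G : WGraph n) (Anext : Finset (Fin n)) (d : ℕ) (w : Fin n) :
    Set (Fin n) :=
  {u | u ∈ G.cluster Anext w ∧ G.dist u w ≤ d}

end WGraph

/-! ### The algorithm

Every tree is an Even–Shiloach tree of bounded radius. It stores the level of each vertex
(`⊤` for a vertex outside the tree) and, at each vertex `y`, a heap with one key for each
neighbour `x`, namely the level of `x` plus the weight of the edge `xy` at the time of writing.
The adjacency list of a vertex `v` is read only by `setLevel`, which passes a new level of `v` on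
to the heaps of the neighbours of `v`; this is a scan of the edges incident on `v`, and each one
is counted. -/

/-- The memory of one tree, together with the number of scans made so far at each vertex. -/
structure Tree (n : ℕ) where
  level : Fin n → ℕ∞
  key : Fin n → Fin n → ℕ∞
  scans : Fin n → ℕ

namespace Tree

variable {n : ℕ}

def empty (n : ℕ) : Tree n where
  level := fun _ => ⊤
  key := fun _ _ => ⊤
  scans := fun _ => 0

/-- The candidate level of `v`: zero at a root, and the minimum of the heap of `v` elsewhere. -/
noncomputable def cand (roots : Finset (Fin n)) (T : Tree n) (v : Fin n) : ℕ∞ :=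
  if v ∈ roots then 0 else Finset.univ.inf (T.key v)

/-- Change the level of `v` to `l` and scan the edges incident on `v`. -/
noncomputable def setLevel (G : WGraph n) (T : Tree n) (v : Fin n) (l : ℕ∞) : Tree n where
  level := Function.update T.level v l
  key := fun y x => if x = v then l + G.len v y else T.key y x
  scans := Function.update T.scans v (T.scans v + 1)

/-- Take one vertex out of the tree whose level is no longer attained by its candidate. -/
noncomputable def detachStep (G : WGraph n) (roots : Finset (Fin n)) (T : Tree n) : Tree n :=
  match (List.finRange n).find? (fun v => decide (T.level v < T.cand roots v)) with
  | none => T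
  | some v => T.setLevel G v ⊤

/-- One step of the modified Dijkstra algorithm. The queue holds the vertices `v` outside the tree
with a candidate below the radius `cap v`; one of least candidate is extracted and joins. -/
noncomputable def attachStep (G : WGraph n) (roots : Finset (Fin n)) (cap : Fin n → ℕ∞)
    (T : Tree n) : Tree n :=
  match ((List.finRange n).filter
      (fun v => decide (T.level v = ⊤ ∧ T.cand roots v < cap v))).argmin (T.cand roots) with
  | none => T
  | some v => T.setLevel G v (T.cand roots v)

/-- Run `detachStep` until nothing changes: each vertex is taken out at most once, so that
`n` rounds are enough. -/
noncomputable def detach (G : WGraph n) (roots : Finset (Fin n)) (T : Tree n) : Tree n :=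
  (detachStep G roots)^[n] T

/-- Run `attachStep` until the queue is empty: each vertex joins at most once, so that
`n` rounds are enough. -/
noncomputable def attach (G : WGraph n) (roots : Finset (Fin n)) (cap : Fin n → ℕ∞)
    (T : Tree n) : Tree n :=
  (attachStep G roots cap)^[n] T

/-- Renew the keys that belong to the touched edge `e`, in the heaps of its two endpoints. -/
noncomputable def touch (G : WGraph n) (e : Sym2 (Fin n)) (T : Tree n) : Tree n where
  level := T.level
  key := fun y x => if s(x, y) = e then T.level x + G.len x y else T.key y x
  scans := T.scans

/-- The tree built on the initial graph. -/
noncomputable def init (G : WGraph n) (roots : Finset (Fin n)) (cap : Fin n → ℕ∞) : Tree n :=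
  (empty n).attach G roots cap

/-- Repair a tree after an update of the edge `e`; `G` is the graph after the update, and `cap`
holds the radii after the update. -/
noncomputable def repair (G : WGraph n) (e : Sym2 (Fin n)) (roots : Finset (Fin n))
    (cap : Fin n → ℕ∞) (T : Tree n) : Tree n :=
  ((T.touch G e).detach G roots).attach G roots cap

end Tree

/-- The data structure of one level `i`: the current graph, a tree that maintains the distances
up to `d` to `A_{i+1}`, and one cluster tree for each center `w ∈ A_i`. -/
structure LevelData (n : ℕ) where
  graph : WGraph n
  pivotTree : Tree n
  clusterTree : Fin n → Tree n

namespace LevelData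

variable {n : ℕ}

/-- The radius at `v` of the cluster trees: the maintained distance to `A_{i+1}`, cut off
at `d + 1`. -/
noncomputable def radius (d : ℕ) (pivotTree : Tree n) (v : Fin n) : ℕ∞ :=
  min ((d : ℕ∞) + 1) (pivotTree.level v)

/-- Initialisation, with `Acur = A_i` and `Anext = A_{i+1}`. -/
noncomputable def init (d : ℕ) (Acur Anext : Finset (Fin n)) (G : WGraph n) : LevelData n :=
  let P := Tree.init G Anext (fun _ => (d : ℕ∞) + 1)
  { graph := G
    pivotTree := P
    clusterTree := fun w =>
      if w ∈ Acur then Tree.init G {w} (radius d P) else Tree.empty n }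

/-- Processing of one update. -/
noncomputable def step (d : ℕ) (Acur Anext : Finset (Fin n)) (D : LevelData n)
    (u : Update n) : LevelData n :=
  let G := D.graph.apply u
  let P := D.pivotTree.repair G u.edge Anext (fun _ => (d : ℕ∞) + 1)
  { graph := G
    pivotTree := P
    clusterTree := fun w =>
      if w ∈ Acur then (D.clusterTree w).repair G u.edge {w} (radius d P)
      else D.clusterTree w }

/-- The data structure after processing the updates `us` one after the other. -/
noncomputable def run (d : ℕ) (Acur Anext : Finset (Fin n)) (G : WGraph n)
    (us : List (Update n)) : LevelData n :=
  us.foldl (step d Acur Anext) (init d Acur Anext G)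

/-- The number of times the edges incident on `v` have been scanned, over all cluster trees
of the centers in `A_i`. -/
def totalScans (Acur : Finset (Fin n)) (D : LevelData n) (v : Fin n) : ℕ :=
  ∑ w ∈ Acur, (D.clusterTree w).scans v

end LevelData

/-! ### The sampled sets -/

/-- The sub-sampling probability `q_i = max (n ^ (-2 ^ i * ν)) (n ^ (-ρ))`, `ν = 1 / (2 ^ k - 1)`. -/
noncomputable def sampleProb (n k : ℕ) (ρ : ℝ) (i : ℕ) : ℝ :=
  max ((n : ℝ) ^ (-((2 : ℝ) ^ i * (1 / ((2 : ℝ) ^ k - 1))))) ((n : ℝ) ^ (-ρ))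

/-- The index `k + 1/ρ + 1` of the first set that is empty by definition (`1/ρ` rounded up). -/
noncomputable def numLevels (k : ℕ) (ρ : ℝ) : ℕ := k + ⌈1 / ρ⌉₊ + 1

open Classical in
/-- The sets `V = A_0 ⊇ A_1 ⊇ … ⊇ A_L = ∅`: a vertex `v` of `A_j` is kept in `A_{j+1}`
if the event `coin j v` occurs. -/
noncomputable def hierarchy {Ω : Type*} {n : ℕ} (L : ℕ) (coin : ℕ → Fin n → Set Ω) (ω : Ω) :
    ℕ → Finset (Fin n)
  | 0 => Finset.univ
  | j + 1 => if j + 1 < L then {v ∈ hierarchy L coin ω j | ω ∈ coin j v} else ∅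

end DecrementalClusters

open DecrementalClusters

namespace DecrementalClusters

namespace WGraph

variable {n : ℕ}

theorem len_of_adj (G : WGraph n) {x y : Fin n} (h : G.graph.Adj x y) :
    G.len x y = (G.weight s(x, y) : ℕ∞) := if_pos h

theorem len_of_not_adj (G : WGraph n) {x y : Fin n} (h : ¬ G.graph.Adj x y) :
    G.len x y = ⊤ := if_neg h

theorem len_pos (G : WGraph n) (x y : Fin n) : 0 < G.len x y := by
  by_cases h : G.graph.Adj x y
  · rw [len_of_adj _ h]
    exact_mod_cast G.weight_pos s(x, y) h
  · rw [len_of_not_adj _ h]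
    exact ENat.top_pos

theorem graph_apply_le (G : WGraph n) (u : Update n) : (G.apply u).graph ≤ G.graph := by
  cases u with
  | delete e => exact SimpleGraph.deleteEdges_le _
  | increase e δ => exact le_rfl

theorem weight_le_weight_apply (G : WGraph n) (u : Update n) (e : Sym2 (Fin n)) :
    G.weight e ≤ (G.apply u).weight e := by
  cases u with
  | delete f => exact le_rfl
  | increase f δ =>
    change G.weight e ≤ Function.update G.weight f (G.weight f + δ) e
    by_cases h : e = f
    · subst h; simp
    · simp [Function.update_of_ne h]

theorem len_le_len_apply (G : WGraph n) (u : Update n) (x y : Fin n) :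
    G.len x y ≤ (G.apply u).len x y := by
  by_cases h : (G.apply u).graph.Adj x y
  · rw [len_of_adj _ h, len_of_adj _ (graph_apply_le G u h)]
    exact_mod_cast weight_le_weight_apply G u _
  · rw [len_of_not_adj _ h]
    exact le_top

theorem len_apply_of_ne (G : WGraph n) (u : Update n) {x y : Fin n} (h : s(x, y) ≠ u.edge) :
    (G.apply u).len x y = G.len x y := by
  have hadj : (G.apply u).graph.Adj x y ↔ G.graph.Adj x y := by
    cases u with
    | delete e =>
      have h' : s(x, y) ≠ e := h
      change (G.graph.deleteEdges {e}).Adj x y ↔ _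
      simp [SimpleGraph.deleteEdges_adj, h']
    | increase e δ => exact Iff.rfl
  have hw : (G.apply u).weight s(x, y) = G.weight s(x, y) := by
    cases u with
    | delete e => rfl
    | increase e δ => exact Function.update_of_ne h _ _
  by_cases h : G.graph.Adj x y
  · rw [len_of_adj _ h, len_of_adj _ (hadj.2 h), hw]
  · rw [len_of_not_adj _ h, len_of_not_adj _ fun h' => h (hadj.1 h')]

theorem distSet_of_mem (G : WGraph n) {v : Fin n} {R : Finset (Fin n)} (h : v ∈ R) :
    G.distSet v R = 0 := by
  have h1 : G.distSet v R ≤ G.dist v v := iInf₂_le v h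
  have h2 : G.dist v v ≤ (((SimpleGraph.Walk.nil : G.graph.Walk v v).edges.map
    G.weight).sum : ℕ) := iInf_le _ _
  simpa using h1.trans h2

theorem distSet_singleton (G : WGraph n) (v w : Fin n) : G.distSet v {w} = G.dist v w := by
  simp [distSet]

theorem distSet_le_add_len (G : WGraph n) (R : Finset (Fin n)) (v x : Fin n) :
    G.distSet v R ≤ G.distSet x R + G.len x v := by
  by_cases h : G.graph.Adj x v
  · rw [len_of_adj _ h]
    unfold distSet dist
    simp only [ENat.iInf_add]
    refine le_iInf₂ fun a ha => le_iInf fun p => ?_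
    refine (iInf₂_le a ha).trans ((iInf_le _ (SimpleGraph.Walk.cons h.symm p)).trans ?_)
    rw [SimpleGraph.Walk.edges_cons, List.map_cons, List.sum_cons, Sym2.eq_swap]
    push_cast
    rw [add_comm]
  · simp [len_of_not_adj _ h]

theorem exists_distSet_add_len_le (G : WGraph n) {R : Finset (Fin n)} {v : Fin n} (hv : v ∉ R)
    (h : G.distSet v R ≠ ⊤) : ∃ x, G.distSet x R + G.len x v ≤ G.distSet v R := by
  by_contra! hx
  refine lt_irrefl (G.distSet v R) ?_
  obtain ⟨m, hm⟩ := ENat.ne_top_iff_exists.1 h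
  suffices G.distSet v R + 1 ≤ G.distSet v R by
    rw [← hm] at this ⊢
    norm_cast at this
    omega
  conv_rhs => unfold distSet dist
  refine le_iInf₂ fun a ha => le_iInf fun p => ?_
  cases p with
  | nil => exact absurd ha hv
  | @cons _ x _ hadj p =>
    refine (Order.add_one_le_of_lt (hx x)).trans ?_
    have h1 : G.distSet x R ≤ ((p.edges.map G.weight).sum : ℕ) :=
      (iInf₂_le a ha).trans (iInf_le _ p)
    rw [len_of_adj _ hadj.symm, SimpleGraph.Walk.edges_cons, List.map_cons, List.sum_cons,
      Sym2.eq_swap, Nat.cast_add, add_comm]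
    gcongr

theorem lt_of_add_len_le (G : WGraph n) {x y : Fin n} {a b : ℕ∞} (hb : b ≠ ⊤)
    (h : a + G.len x y ≤ b) : a < b := by
  have ha : a ≠ ⊤ := by rintro rfl; simp_all
  exact (ENat.add_one_le_iff ha).1
    ((add_le_add_right (Order.one_le_iff_pos.2 (G.len_pos x y)) a).trans h)

theorem distSet_le_distSet_apply (G : WGraph n) (u : Update n) (R : Finset (Fin n)) (v : Fin n) :
    G.distSet v R ≤ (G.apply u).distSet v R := by
  induction hD : (G.apply u).distSet v R using WellFoundedLT.induction generalizing v with
  | ind b ih =>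
    subst hD
    by_cases hv : v ∈ R
    · simp [distSet_of_mem _ hv]
    by_cases ht : (G.apply u).distSet v R = ⊤
    · simp [ht]
    obtain ⟨x, hx⟩ := exists_distSet_add_len_le _ hv ht
    calc G.distSet v R ≤ G.distSet x R + G.len x v := distSet_le_add_len ..
      _ ≤ (G.apply u).distSet x R + (G.apply u).len x v :=
        add_le_add (ih _ (lt_of_add_len_le _ ht hx) x rfl) (len_le_len_apply ..)
      _ ≤ _ := hx

theorem applyAll_concat (G : WGraph n) (us : List (Update n)) (u : Update n) :
    G.applyAll (us ++ [u]) = (G.applyAll us).apply u := by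
  simp [applyAll]

theorem distSet_applyAll_mono (G : WGraph n) (R : Finset (Fin n)) (v : Fin n)
    {us us' : List (Update n)} (h : us <+: us') :
    (G.applyAll us).distSet v R ≤ (G.applyAll us').distSet v R := by
  obtain ⟨l, rfl⟩ := h
  induction l using List.reverseRecOn with
  | nil => simp
  | append_singleton l u ih =>
    rw [← List.append_assoc, applyAll_concat]
    exact ih.trans (distSet_le_distSet_apply ..)

end WGraph

theorem iterate_of_measure {α : Type*} (f : α → α) (m : α → ℕ) (P : α → Prop)
    (hfix : ∀ a, P a → f a = a) (hlt : ∀ a, ¬ P a → m (f a) < m a) :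
    ∀ (k : ℕ) (a : α), m a ≤ k → P (f^[k] a)
  | 0, a, h => by
    by_contra hP
    have := hlt a hP
    omega
  | k + 1, a, h => by
    rw [Function.iterate_succ_apply]
    by_cases hP : P a
    · rw [hfix a hP, Function.iterate_fixed (hfix a hP)]
      exact hP
    · exact iterate_of_measure f m P hfix hlt k (f a) (by have := hlt a hP; omega)

theorem iterate_induction {α : Type*} {f : α → α} {P : α → Prop} (h : ∀ a, P a → P (f a))
    (k : ℕ) {a : α} (ha : P a) : P (f^[k] a) :=
  Function.Iterate.rec P ha h k

namespace Tree

variable {n : ℕ}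

/-- Every key is the current level of the neighbour plus the length of the edge. -/
def KeysValid (G : WGraph n) (T : Tree n) : Prop :=
  ∀ y x, T.key y x = T.level x + G.len x y

/-- The radii vary by at most the length of an edge along that edge. -/
def IsRadius (G : WGraph n) (cap : Fin n → ℕ∞) : Prop :=
  ∀ v x, cap v ≤ cap x + G.len x v

/-- The tree consists of the vertices whose distance to the roots is below the radius, and their
levels are these distances. -/
structure IsCorrect (G : WGraph n) (R : Finset (Fin n)) (cap : Fin n → ℕ∞) (T : Tree n) :
    Prop where
  keys : KeysValid G T
  level_of_lt : ∀ v, G.distSet v R < cap v → T.level v = G.distSet v R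
  level_of_le : ∀ v, cap v ≤ G.distSet v R → T.level v = ⊤

/-- The vertices of the tree have the correct level, but some vertices may be missing. -/
structure IsPartial (G : WGraph n) (R : Finset (Fin n)) (cap : Fin n → ℕ∞) (T : Tree n) :
    Prop where
  keys : KeysValid G T
  level_eq : ∀ v, T.level v ≠ ⊤ → T.level v = G.distSet v R
  lt_cap : ∀ v, T.level v ≠ ⊤ → G.distSet v R < cap v

/-- While the tree is being repaired for `G'`, its levels are those of `G`, and it still has all
the vertices whose distance has not changed. -/
structure IsDetaching (G G' : WGraph n) (R : Finset (Fin n)) (cap : Fin n → ℕ∞) (T : Tree n) :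
    Prop where
  keys : KeysValid G' T
  level_eq : ∀ v, T.level v ≠ ⊤ → T.level v = G.distSet v R
  lt_cap : ∀ v, T.level v ≠ ⊤ → G.distSet v R < cap v
  level_of_eq : ∀ v, G.distSet v R < cap v → G'.distSet v R = G.distSet v R →
    T.level v = G.distSet v R

section Candidates

variable {G : WGraph n} {R : Finset (Fin n)} {T : Tree n}

theorem cand_of_mem {v : Fin n} (h : v ∈ R) : T.cand R v = 0 := if_pos h

theorem cand_le (hT : KeysValid G T) (v x : Fin n) : T.cand R v ≤ T.level x + G.len x v := by
  unfold cand
  split_ifs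
  · exact zero_le
  · rw [← hT v x]
    exact Finset.inf_le (Finset.mem_univ x)

theorem exists_cand_eq (hT : KeysValid G T) {v : Fin n} (h : v ∉ R) :
    ∃ x, T.cand R v = T.level x + G.len x v := by
  obtain ⟨x, -, hx⟩ := Finset.exists_mem_eq_inf Finset.univ ⟨v, Finset.mem_univ v⟩ (T.key v)
  exact ⟨x, by rw [cand, if_neg h, hx, hT v x]⟩

theorem distSet_le_cand (hT : KeysValid G T) (h : ∀ x, T.level x ≠ ⊤ → G.distSet x R ≤ T.level x)
    (v : Fin n) : G.distSet v R ≤ T.cand R v := by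
  by_cases hv : v ∈ R
  · simp [WGraph.distSet_of_mem _ hv]
  obtain ⟨x, hx⟩ := exists_cand_eq hT hv
  rw [hx]
  by_cases ht : T.level x = ⊤
  · simp [ht]
  · exact (WGraph.distSet_le_add_len ..).trans (by gcongr; exact h x ht)

theorem KeysValid.setLevel (hT : KeysValid G T) (v : Fin n) (l : ℕ∞) :
    KeysValid G (T.setLevel G v l) := by
  intro y x
  by_cases h : x = v
  · subst h; simp [Tree.setLevel]
  · simp [Tree.setLevel, h, hT y x]

theorem keysValid_empty (G : WGraph n) : KeysValid G (empty n) := fun _ _ => by simp [empty]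

theorem KeysValid.touch (hT : KeysValid G T) (u : Update n) :
    KeysValid (G.apply u) (T.touch (G.apply u) u.edge) := by
  intro y x
  by_cases h : s(x, y) = u.edge
  · simp [Tree.touch, h]
  · simp [Tree.touch, h, hT y x, WGraph.len_apply_of_ne G u h]

@[simp] theorem level_setLevel_self (v : Fin n) (l : ℕ∞) : (T.setLevel G v l).level v = l := by
  simp [Tree.setLevel]

theorem level_setLevel_of_ne {v u : Fin n} (l : ℕ∞) (h : u ≠ v) :
    (T.setLevel G v l).level u = T.level u := by
  simp [Tree.setLevel, h]

@[simp] theorem scans_setLevel_self (v : Fin n) (l : ℕ∞) :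
    (T.setLevel G v l).scans v = T.scans v + 1 := by
  simp [Tree.setLevel]

theorem scans_setLevel_of_ne {v u : Fin n} (l : ℕ∞) (h : u ≠ v) :
    (T.setLevel G v l).scans u = T.scans u := by
  simp [Tree.setLevel, h]

end Candidates

section Steps

theorem detachStep_cases (G : WGraph n) (R : Finset (Fin n)) (T : Tree n) :
    ((∀ v, ¬ T.level v < T.cand R v) ∧ detachStep G R T = T) ∨
      ∃ v, T.level v < T.cand R v ∧ detachStep G R T = T.setLevel G v ⊤ := by
  unfold detachStep
  split
  · next h => exact .inl ⟨fun v => by simpa using List.find?_eq_none.1 h v (by simp), rfl⟩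
  · next v h => exact .inr ⟨v, by simpa using List.find?_some h, rfl⟩

theorem attachStep_cases (G : WGraph n) (R : Finset (Fin n)) (cap : Fin n → ℕ∞) (T : Tree n) :
    ((∀ v, T.level v = ⊤ → ¬ T.cand R v < cap v) ∧ attachStep G R cap T = T) ∨
      ∃ v, T.level v = ⊤ ∧ T.cand R v < cap v ∧
        (∀ u, T.level u = ⊤ → T.cand R u < cap u → T.cand R v ≤ T.cand R u) ∧
        attachStep G R cap T = T.setLevel G v (T.cand R v) := by
  unfold attachStep
  split
  · next h =>
    rw [List.argmin_eq_none, List.filter_eq_nil_iff] at h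
    exact .inl ⟨fun v hv hc => h v (by simp) (by simp [hv, hc]), rfl⟩
  · next v h =>
    have hm := List.argmin_mem h
    simp only [List.mem_filter, List.mem_finRange, true_and, decide_eq_true_eq] at hm
    refine .inr ⟨v, hm.1, hm.2, fun u hu hc => ?_, rfl⟩
    exact List.le_of_mem_argmin (by simp [hu, hc]) h

/-- The number of vertices in the tree. -/
noncomputable def size (T : Tree n) : ℕ := (Finset.univ.filter fun v => T.level v ≠ ⊤).card

theorem size_setLevel_top {G : WGraph n} {T : Tree n} {v : Fin n} (h : T.level v ≠ ⊤) :
    (T.setLevel G v ⊤).size < T.size := by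
  refine Finset.card_lt_card (Finset.ssubset_iff_of_subset ?_ |>.2 ⟨v, by simp [h], by simp⟩)
  intro u
  by_cases hu : u = v
  · subst hu; simp
  · simp [level_setLevel_of_ne _ hu]

theorem size_lt_size_setLevel {G : WGraph n} {T : Tree n} {v : Fin n} {l : ℕ∞}
    (h : T.level v = ⊤) (hl : l ≠ ⊤) : T.size < (T.setLevel G v l).size := by
  refine Finset.card_lt_card (Finset.ssubset_iff_of_subset ?_ |>.2 ⟨v, by simp [hl], by simp [h]⟩)
  intro u
  by_cases hu : u = v
  · subst hu; simp [h]
  · simp [level_setLevel_of_ne _ hu]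

theorem size_le (T : Tree n) : T.size ≤ n := by
  simpa [size] using Finset.card_filter_le (Finset.univ : Finset (Fin n)) fun v => T.level v ≠ ⊤

theorem not_level_lt_cand_detach (G : WGraph n) (R : Finset (Fin n)) (T : Tree n) (v : Fin n) :
    ¬ (T.detach G R).level v < (T.detach G R).cand R v := by
  refine iterate_of_measure (detachStep G R) size (fun T => ∀ v, ¬ T.level v < T.cand R v)
    (fun T hT => ?_) (fun T hT => ?_) n T T.size_le v
  · rcases detachStep_cases G R T with h | ⟨v, hv, -⟩
    exacts [h.2, absurd hv (hT v)]
  · rcases detachStep_cases G R T with h | ⟨v, hv, h⟩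
    · exact absurd h.1 hT
    · rw [h]
      exact size_setLevel_top hv.ne_top

theorem not_cand_lt_attach (G : WGraph n) (R : Finset (Fin n)) (cap : Fin n → ℕ∞) (T : Tree n)
    (v : Fin n) (hv : (T.attach G R cap).level v = ⊤) :
    ¬ (T.attach G R cap).cand R v < cap v := by
  refine iterate_of_measure (attachStep G R cap) (fun T => n - T.size)
    (fun T => ∀ v, T.level v = ⊤ → ¬ T.cand R v < cap v)
    (fun T hT => ?_) (fun T hT => ?_) n T (Nat.sub_le _ _) v hv
  · rcases attachStep_cases G R cap T with h | ⟨v, hv, hc, -⟩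
    exacts [h.2, absurd hc (hT v hv)]
  · rcases attachStep_cases G R cap T with h | ⟨v, hv, hc, -, h⟩
    · exact absurd h.1 hT
    · rw [h]
      have h1 := size_lt_size_setLevel (G := G) hv hc.ne_top
      have h2 := (T.setLevel G v (T.cand R v)).size_le
      omega

/-- A vertex that is taken out of the tree is scanned once. -/
theorem detach_scans (G : WGraph n) (R : Finset (Fin n)) (T : Tree n) (v : Fin n) :
    ((T.detach G R).level v = T.level v ∧ (T.detach G R).scans v = T.scans v) ∨
      (T.level v ≠ ⊤ ∧ (T.detach G R).level v = ⊤ ∧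
        (T.detach G R).scans v = T.scans v + 1) := by
  refine iterate_induction (P := fun S : Tree n => (S.level v = T.level v ∧ S.scans v = T.scans v) ∨
    (T.level v ≠ ⊤ ∧ S.level v = ⊤ ∧ S.scans v = T.scans v + 1)) (fun S hS => ?_) n
    (.inl ⟨rfl, rfl⟩)
  rcases detachStep_cases G R S with ⟨-, h⟩ | ⟨u, hu, h⟩
  · rwa [h]
  · rw [h]
    by_cases huv : v = u
    · subst huv
      rcases hS with hS | hS
      · exact .inr ⟨hS.1 ▸ hu.ne_top, by simp, by simp [hS.2]⟩
      · exact absurd hS.2.1 hu.ne_top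
    · rwa [level_setLevel_of_ne _ huv, scans_setLevel_of_ne _ huv]

/-- A vertex that joins the tree is scanned once. -/
theorem attach_scans (G : WGraph n) (R : Finset (Fin n)) (cap : Fin n → ℕ∞) (T : Tree n)
    (v : Fin n) :
    ((T.attach G R cap).level v = T.level v ∧ (T.attach G R cap).scans v = T.scans v) ∨
      (T.level v = ⊤ ∧ (T.attach G R cap).level v ≠ ⊤ ∧
        (T.attach G R cap).scans v = T.scans v + 1) := by
  refine iterate_induction (P := fun S : Tree n => (S.level v = T.level v ∧ S.scans v = T.scans v) ∨
    (T.level v = ⊤ ∧ S.level v ≠ ⊤ ∧ S.scans v = T.scans v + 1)) (fun S hS => ?_) n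
    (.inl ⟨rfl, rfl⟩)
  rcases attachStep_cases G R cap S with ⟨-, h⟩ | ⟨u, hu, hc, -, h⟩
  · rwa [h]
  · rw [h]
    by_cases huv : v = u
    · subst huv
      rcases hS with hS | hS
      · exact .inr ⟨hS.1 ▸ hu, by simpa using hc.ne_top, by simp [hS.2]⟩
      · exact absurd hu hS.2.1
    · rwa [level_setLevel_of_ne _ huv, scans_setLevel_of_ne _ huv]

end Steps

section Correctness

variable {G G' : WGraph n} {R : Finset (Fin n)} {cap cap' : Fin n → ℕ∞} {T : Tree n}

theorem IsRadius.lt_of_add_len_le (hcap : IsRadius G cap) {v x : Fin n} {a b : ℕ∞}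
    (h : a + G.len x v ≤ b) (hb : b < cap v) : a < cap x :=
  lt_of_add_lt_add_right ((h.trans_lt hb).trans_le (hcap v x))

theorem IsDetaching.detachStep (hlen : ∀ x y, G.len x y ≤ G'.len x y)
    (hdist : ∀ v, G.distSet v R ≤ G'.distSet v R) (hcap : IsRadius G cap)
    (hT : IsDetaching G G' R cap T) : IsDetaching G G' R cap (T.detachStep G' R) := by
  rcases detachStep_cases G' R T with ⟨-, h⟩ | ⟨v, hv, h⟩
  · rwa [h]
  rw [h]
  refine ⟨hT.keys.setLevel v ⊤, fun u hu => ?_, fun u hu => ?_, fun u hu he => ?_⟩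
  · by_cases huv : u = v
    · subst huv; simp at hu
    · rw [level_setLevel_of_ne _ huv] at hu ⊢
      exact hT.level_eq u hu
  · by_cases huv : u = v
    · subst huv; simp at hu
    · rw [level_setLevel_of_ne _ huv] at hu
      exact hT.lt_cap u hu
  · by_cases huv : u = v
    · subst huv
      exfalso
      by_cases hR : u ∈ R
      · simp [cand_of_mem hR] at hv
      obtain ⟨x, hx⟩ := WGraph.exists_distSet_add_len_le G' hR (he ▸ hu.ne_top)
      have hlv := hT.level_of_eq u hu he
      have hx' : G'.distSet x R + G'.len x u ≤ G.distSet u R := hx.trans he.le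
      have hfin : G'.len x u ≠ ⊤ := fun htop => hu.ne_top (by simpa [htop] using hx')
      have hxe : G'.distSet x R = G.distSet x R := by
        refine le_antisymm ?_ (hdist x)
        refine (WithTop.add_le_add_iff_right hfin).1 (hx'.trans ?_)
        exact (WGraph.distSet_le_add_len G R u x).trans (add_le_add le_rfl (hlen x u))
      have hxc : G.distSet x R < cap x := by
        refine hcap.lt_of_add_len_le (v := u) (le_trans ?_ hx') hu
        exact add_le_add (hdist x) (hlen x u)
      have hc := cand_le (R := R) hT.keys u x
      rw [hT.level_of_eq x hxc hxe, ← hxe] at hc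
      exact absurd (hc.trans (hx'.trans hlv.ge)) (not_le_of_gt hv)
    · rw [level_setLevel_of_ne _ huv]
      exact hT.level_of_eq u hu he

theorem IsDetaching.detach (hlen : ∀ x y, G.len x y ≤ G'.len x y)
    (hdist : ∀ v, G.distSet v R ≤ G'.distSet v R) (hcap : IsRadius G cap)
    (hT : IsDetaching G G' R cap T) : IsDetaching G G' R cap (T.detach G' R) :=
  iterate_induction (fun _ h => h.detachStep hlen hdist hcap) n hT

theorem distSet_le_level (hT : KeysValid G T) (h : ∀ v, ¬ T.level v < T.cand R v) (v : Fin n) :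
    G.distSet v R ≤ T.level v := by
  induction hl : T.level v using WellFoundedLT.induction generalizing v with
  | ind b ih =>
    subst hl
    by_cases hv : v ∈ R
    · simp [WGraph.distSet_of_mem _ hv]
    by_cases ht : T.level v = ⊤
    · simp [ht]
    obtain ⟨x, hx⟩ := exists_cand_eq hT hv
    have hle : T.level x + G.len x v ≤ T.level v := hx ▸ not_lt.1 (h v)
    exact (WGraph.distSet_le_add_len G R v x).trans
      ((add_le_add (ih _ (G.lt_of_add_len_le ht hle) x rfl) le_rfl).trans hle)

theorem IsDetaching.isPartial (hdist : ∀ v, G.distSet v R ≤ G'.distSet v R)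
    (hcap : ∀ v, cap v ≤ cap' v) (hT : IsDetaching G G' R cap T)
    (h : ∀ v, ¬ T.level v < T.cand R v) : IsPartial G' R cap' T := by
  have key : ∀ v, T.level v ≠ ⊤ → T.level v = G'.distSet v R := fun v hv =>
    le_antisymm ((hT.level_eq v hv).trans_le (hdist v)) (distSet_le_level hT.keys h v)
  refine ⟨hT.keys, key, fun v hv => ?_⟩
  rw [← key v hv, hT.level_eq v hv]
  exact (hT.lt_cap v hv).trans_le (hcap v)

/-- If a vertex is missing, then the queue has a vertex whose key is at most its distance. -/
theorem IsPartial.exists_cand_le (hcap : IsRadius G cap) (hT : IsPartial G R cap T) {v : Fin n}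
    (hv : G.distSet v R < cap v) (hl : T.level v = ⊤) :
    ∃ y, T.level y = ⊤ ∧ T.cand R y < cap y ∧ T.cand R y ≤ G.distSet v R := by
  induction hD : G.distSet v R using WellFoundedLT.induction generalizing v with
  | ind b ih =>
    subst hD
    by_cases hR : v ∈ R
    · exact ⟨v, hl, by rw [cand_of_mem hR]; exact bot_le.trans_lt hv,
        by rw [cand_of_mem hR]; exact bot_le⟩
    obtain ⟨x, hx⟩ := WGraph.exists_distSet_add_len_le G hR hv.ne_top
    have hxv := G.lt_of_add_len_le hv.ne_top hx
    by_cases hlx : T.level x = ⊤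
    · obtain ⟨y, h1, h2, h3⟩ := ih _ hxv (hcap.lt_of_add_len_le hx hv) hlx rfl
      exact ⟨y, h1, h2, h3.trans hxv.le⟩
    · have hc := cand_le (R := R) hT.keys v x
      rw [hT.level_eq x hlx] at hc
      exact ⟨v, hl, (hc.trans hx).trans_lt hv, hc.trans hx⟩

theorem IsPartial.attachStep (hcap : IsRadius G cap) (hT : IsPartial G R cap T) :
    IsPartial G R cap (T.attachStep G R cap) := by
  rcases attachStep_cases G R cap T with ⟨-, h⟩ | ⟨v, hv, hc, hmin, h⟩
  · rwa [h]
  rw [h]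
  have hle : G.distSet v R ≤ T.cand R v :=
    distSet_le_cand hT.keys (fun x hx => (hT.level_eq x hx).ge) v
  have heq : T.cand R v = G.distSet v R := by
    obtain ⟨y, h1, h2, h3⟩ := hT.exists_cand_le hcap (hle.trans_lt hc) hv
    exact le_antisymm ((hmin y h1 h2).trans h3) hle
  refine ⟨hT.keys.setLevel v _, fun u hu => ?_, fun u hu => ?_⟩
  · by_cases huv : u = v
    · subst huv; simpa using heq
    · rw [level_setLevel_of_ne _ huv] at hu ⊢
      exact hT.level_eq u hu
  · by_cases huv : u = v
    · subst huv; exact hle.trans_lt hc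
    · rw [level_setLevel_of_ne _ huv] at hu
      exact hT.lt_cap u hu

theorem IsPartial.isCorrect_attach (hcap : IsRadius G cap) (hT : IsPartial G R cap T) :
    IsCorrect G R cap (T.attach G R cap) := by
  have hA : IsPartial G R cap (T.attach G R cap) :=
    iterate_induction (fun _ h => h.attachStep hcap) n hT
  refine ⟨hA.keys, fun v hv => ?_, fun v hv => ?_⟩
  · refine hA.level_eq v fun hl => ?_
    obtain ⟨y, h1, h2, -⟩ := hA.exists_cand_le hcap hv hl
    exact not_cand_lt_attach G R cap T y h1 h2
  · by_contra hl
    exact absurd (hA.lt_cap v hl) (not_lt_of_ge hv)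

theorem isCorrect_init (hcap : IsRadius G cap) : IsCorrect G R cap (Tree.init G R cap) :=
  IsPartial.isCorrect_attach hcap
    ⟨keysValid_empty G, fun _ h => absurd rfl h, fun _ h => absurd rfl h⟩

theorem IsCorrect.level_ne_top_iff (hT : IsCorrect G R cap T) (v : Fin n) :
    T.level v ≠ ⊤ ↔ G.distSet v R < cap v := by
  constructor
  · intro h
    by_contra h'
    exact h (hT.level_of_le v (not_lt.1 h'))
  · intro h
    rw [hT.level_of_lt v h]
    exact h.ne_top

theorem IsCorrect.isDetaching_touch (u : Update n) (hT : IsCorrect G R cap T) :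
    IsDetaching G (G.apply u) R cap (T.touch (G.apply u) u.edge) :=
  ⟨hT.keys.touch u, fun v hv => hT.level_of_lt v ((hT.level_ne_top_iff v).1 hv),
    fun v hv => (hT.level_ne_top_iff v).1 hv, fun v hv _ => hT.level_of_lt v hv⟩

variable {u : Update n}

theorem IsCorrect.repair (hcap : IsRadius G cap) (hcap' : IsRadius (G.apply u) cap')
    (hle : ∀ v, cap v ≤ cap' v) (hT : IsCorrect G R cap T) :
    IsCorrect (G.apply u) R cap' (T.repair (G.apply u) u.edge R cap') :=
  IsPartial.isCorrect_attach hcap' <|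
    ((hT.isDetaching_touch u).detach (G.len_le_len_apply u) (G.distSet_le_distSet_apply u R)
      hcap).isPartial (G.distSet_le_distSet_apply u R) hle
      (not_level_lt_cand_detach _ _ _)

/-- A vertex of the tree whose distance does not change is not scanned. -/
theorem IsCorrect.scans_repair_of_eq (hcap : IsRadius G cap) (cap' : Fin n → ℕ∞)
    (hT : IsCorrect G R cap T) {v : Fin n} (hv : G.distSet v R < cap v)
    (he : (G.apply u).distSet v R = G.distSet v R) :
    (T.repair (G.apply u) u.edge R cap').scans v = T.scans v := by
  have hD := ((hT.isDetaching_touch u).detach (G.len_le_len_apply u)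
    (G.distSet_le_distSet_apply u R) hcap).level_of_eq v hv he
  have h1 : ((T.touch (G.apply u) u.edge).detach (G.apply u) R).scans v = T.scans v := by
    rcases detach_scans (G.apply u) R (T.touch (G.apply u) u.edge) v with h | h
    · exact h.2
    · exact absurd (hD ▸ h.2.1) hv.ne_top
  rcases attach_scans (G.apply u) R cap' ((T.touch (G.apply u) u.edge).detach (G.apply u) R) v
    with h | h
  · exact h.2.trans h1
  · exact absurd (hD ▸ h.1) hv.ne_top

theorem scans_repair_le (G : WGraph n) (e : Sym2 (Fin n)) (R : Finset (Fin n))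
    (cap : Fin n → ℕ∞) (T : Tree n) (v : Fin n) :
    (T.repair G e R cap).scans v ≤ T.scans v + (if T.level v = ⊤ then 0 else 1) +
      (if (T.repair G e R cap).level v = ⊤ then 0 else 1) := by
  have h1 := detach_scans G R (T.touch G e) v
  have h2 := attach_scans G R cap ((T.touch G e).detach G R) v
  change (_ = T.level v ∧ _ = T.scans v) ∨ (T.level v ≠ ⊤ ∧ _ ∧ _ = T.scans v + 1) at h1
  unfold Tree.repair
  rcases h1 with h1 | h1 <;> rcases h2 with h2 | h2 <;> split_ifs <;> (simp_all; try omega)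

theorem scans_init_le (G : WGraph n) (R : Finset (Fin n)) (cap : Fin n → ℕ∞) (v : Fin n) :
    (Tree.init G R cap).scans v ≤ if (Tree.init G R cap).level v = ⊤ then 0 else 1 := by
  have h := attach_scans G R cap (empty n) v
  change (_ ∧ _ = 0) ∨ (_ ∧ _ ∧ _ = 0 + 1) at h
  unfold Tree.init
  rcases h with h | h
  · simp [h.2]
  · simp [h.2]

end Correctness

end Tree

variable {n : ℕ}

theorem Tree.isRadius_const (G : WGraph n) (c : ℕ∞) : Tree.IsRadius G fun _ => c :=
  fun _ _ => le_self_add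

/-- The radius of the cluster trees in terms of the distances to `S`. -/
noncomputable def WGraph.cap (G : WGraph n) (S : Finset (Fin n)) (d : ℕ) (v : Fin n) : ℕ∞ :=
  min ((d : ℕ∞) + 1) (G.distSet v S)

theorem WGraph.isRadius_cap (G : WGraph n) (S : Finset (Fin n)) (d : ℕ) :
    Tree.IsRadius G (G.cap S d) := by
  intro v x
  unfold WGraph.cap
  rw [← min_add_add_right]
  exact min_le_min le_self_add (G.distSet_le_add_len S v x)

theorem WGraph.cap_le_cap_applyAll (G : WGraph n) (S : Finset (Fin n)) (d : ℕ) (v : Fin n)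
    {us us' : List (Update n)} (h : us <+: us') :
    (G.applyAll us).cap S d v ≤ (G.applyAll us').cap S d v :=
  min_le_min le_rfl (G.distSet_applyAll_mono S v h)

namespace LevelData

theorem radius_eq_cap {G : WGraph n} {S : Finset (Fin n)} {d : ℕ} {P : Tree n}
    (hP : P.IsCorrect G S fun _ => (d : ℕ∞) + 1) : radius d P = G.cap S d := by
  funext v
  unfold radius WGraph.cap
  rcases lt_or_ge (G.distSet v S) ((d : ℕ∞) + 1) with h | h
  · rw [hP.level_of_lt v h]
  · rw [hP.level_of_le v h, min_eq_left h, min_eq_left le_top]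

/-- The maintained trees are those of the graph `G`. -/
structure IsCorrect (d : ℕ) (A S : Finset (Fin n)) (G : WGraph n) (D : LevelData n) : Prop where
  graph_eq : D.graph = G
  pivot : D.pivotTree.IsCorrect G S fun _ => (d : ℕ∞) + 1
  cluster : ∀ w ∈ A, (D.clusterTree w).IsCorrect G {w} (G.cap S d)

theorem run_concat (d : ℕ) (A S : Finset (Fin n)) (G : WGraph n) (us : List (Update n))
    (u : Update n) : run d A S G (us ++ [u]) = step d A S (run d A S G us) u := by
  simp [run]

theorem isCorrect_init (d : ℕ) (A S : Finset (Fin n)) (G : WGraph n) :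
    IsCorrect d A S G (init d A S G) := by
  have hP := Tree.isCorrect_init (R := S) (Tree.isRadius_const G ((d : ℕ∞) + 1))
  refine ⟨rfl, hP, fun w hw => ?_⟩
  simp only [init, if_pos hw, radius_eq_cap hP]
  exact Tree.isCorrect_init (G.isRadius_cap S d)

theorem IsCorrect.pivot_step {d : ℕ} {A S : Finset (Fin n)} {G : WGraph n} {D : LevelData n}
    (hD : IsCorrect d A S G D) (u : Update n) :
    (D.pivotTree.repair (G.apply u) u.edge S fun _ => (d : ℕ∞) + 1).IsCorrect (G.apply u) S
      fun _ => (d : ℕ∞) + 1 :=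
  hD.pivot.repair (Tree.isRadius_const _ _) (Tree.isRadius_const _ _) fun _ => le_rfl

theorem IsCorrect.clusterTree_step {d : ℕ} {A S : Finset (Fin n)} {G : WGraph n}
    {D : LevelData n} (hD : IsCorrect d A S G D) (u : Update n) {w : Fin n} (hw : w ∈ A) :
    (step d A S D u).clusterTree w =
      (D.clusterTree w).repair (G.apply u) u.edge {w} ((G.apply u).cap S d) := by
  rw [← radius_eq_cap (hD.pivot_step u)]
  simp [step, if_pos hw, hD.graph_eq]

theorem IsCorrect.step {d : ℕ} {A S : Finset (Fin n)} {G : WGraph n} {D : LevelData n}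
    (hD : IsCorrect d A S G D) (u : Update n) :
    IsCorrect d A S (G.apply u) (step d A S D u) := by
  refine ⟨by simp [LevelData.step, hD.graph_eq], ?_, fun w hw => ?_⟩
  · simpa [LevelData.step, hD.graph_eq] using hD.pivot_step u
  · rw [hD.clusterTree_step u hw]
    exact (hD.cluster w hw).repair (G.isRadius_cap S d) ((G.apply u).isRadius_cap S d)
      fun v => min_le_min le_rfl (G.distSet_le_distSet_apply u S v)

theorem isCorrect_run (d : ℕ) (A S : Finset (Fin n)) (G : WGraph n) (us : List (Update n)) :
    IsCorrect d A S (G.applyAll us) (run d A S G us) := by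
  induction us using List.reverseRecOn with
  | nil => exact isCorrect_init d A S G
  | append_singleton us u ih =>
    rw [run_concat, WGraph.applyAll_concat]
    exact ih.step u

theorem mem_boundedCluster_iff (G : WGraph n) (S : Finset (Fin n)) (d : ℕ) (w v : Fin n) :
    v ∈ G.boundedCluster S d w ↔ G.distSet v {w} < G.cap S d v := by
  rw [WGraph.distSet_singleton, WGraph.cap, lt_min_iff, ENat.lt_add_one_iff (by simp), and_comm]
  rfl

theorem clusterTree_run (d : ℕ) (A S : Finset (Fin n)) (G : WGraph n) (us : List (Update n))
    {w : Fin n} (hw : w ∈ A) :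
    {v | ((run d A S G us).clusterTree w).level v ≠ ⊤} = (G.applyAll us).boundedCluster S d w ∧
      ∀ v ∈ (G.applyAll us).boundedCluster S d w,
        ((run d A S G us).clusterTree w).level v = (G.applyAll us).dist v w := by
  have hT := (isCorrect_run d A S G us).cluster w hw
  refine ⟨Set.ext fun v => ?_, fun v hv => ?_⟩
  · rw [mem_boundedCluster_iff]
    exact hT.level_ne_top_iff v
  · rw [mem_boundedCluster_iff] at hv
    rw [hT.level_of_lt v hv, WGraph.distSet_singleton]

open Classical in
/-- The levels that `v` attains in the tree of `w`. -/
noncomputable def levels (d : ℕ) (S : Finset (Fin n)) (G : WGraph n) (us : List (Update n))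
    (w v : Fin n) : Finset ℕ :=
  {l ∈ Finset.range (d + 1) | ∃ us', us' <+: us ∧ (G.applyAll us').dist v w = l ∧
    (G.applyAll us').dist v w < (G.applyAll us').cap S d v}

theorem levels_subset_concat (d : ℕ) (S : Finset (Fin n)) (G : WGraph n)
    (us : List (Update n)) (u : Update n) (w v : Fin n) :
    levels d S G us w v ⊆ levels d S G (us ++ [u]) w v := by
  intro l
  simp only [levels, Finset.mem_filter]
  rintro ⟨h1, us', h2, h3⟩
  exact ⟨h1, us', h2.trans (List.prefix_append _ _), h3⟩

theorem mem_levels (d : ℕ) (S : Finset (Fin n)) (G : WGraph n) (us : List (Update n))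
    {w v : Fin n} {l : ℕ} (hl : (G.applyAll us).dist v w = l)
    (h : (G.applyAll us).dist v w < (G.applyAll us).cap S d v) :
    l ∈ levels d S G us w v := by
  simp only [levels, Finset.mem_filter, Finset.mem_range]
  refine ⟨?_, us, List.prefix_rfl, hl, h⟩
  have := h.trans_le (min_le_left _ _)
  rw [hl] at this
  exact_mod_cast this

theorem scans_add_le (d : ℕ) (A S : Finset (Fin n)) (G : WGraph n) (us : List (Update n))
    {w : Fin n} (hw : w ∈ A) (v : Fin n) :
    ((run d A S G us).clusterTree w).scans v +
        (if ((run d A S G us).clusterTree w).level v = ⊤ then 0 else 1) ≤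
      2 * (levels d S G us w v).card := by
  induction us using List.reverseRecOn with
  | nil =>
    have hT := (isCorrect_run d A S G []).cluster w hw
    have hs : ((run d A S G []).clusterTree w).scans v ≤
        if ((run d A S G []).clusterTree w).level v = ⊤ then 0 else 1 := by
      simp only [run, List.foldl_nil, init, if_pos hw]
      exact Tree.scans_init_le ..
    by_cases hl : ((run d A S G []).clusterTree w).level v = ⊤
    · simp only [hl, if_true] at hs ⊢
      omega
    · simp only [hl, if_false] at hs ⊢
      have hlt := (hT.level_ne_top_iff v).1 hl
      rw [WGraph.distSet_singleton] at hlt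
      obtain ⟨l, hl⟩ := ENat.ne_top_iff_exists.1 hlt.ne_top
      have := Finset.card_pos.2 ⟨l, mem_levels d S G [] hl.symm hlt⟩
      omega
  | append_singleton us u ih =>
    have hD := isCorrect_run d A S G us
    have hT := hD.cluster w hw
    have hT' := (isCorrect_run d A S G (us ++ [u])).cluster w hw
    have hsub := levels_subset_concat d S G us u w v
    have hcard := Finset.card_le_card hsub
    have hle := Tree.scans_repair_le ((G.applyAll us).apply u) u.edge {w}
      (((G.applyAll us).apply u).cap S d) ((run d A S G us).clusterTree w) v
    have hstep := hD.clusterTree_step u hw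
    rw [← run_concat] at hstep
    rw [← hstep] at hle
    by_cases hl' : ((run d A S G (us ++ [u])).clusterTree w).level v = ⊤
    · simp only [hl', if_true] at hle ⊢
      omega
    have hlt' := (hT'.level_ne_top_iff v).1 hl'
    rw [WGraph.distSet_singleton] at hlt'
    obtain ⟨l, hl⟩ := ENat.ne_top_iff_exists.1 hlt'.ne_top
    have hmem := mem_levels d S G (us ++ [u]) hl.symm hlt'
    simp only [hl', if_false] at hle ⊢
    by_cases hmem0 : l ∈ levels d S G us w v
    · simp only [levels, Finset.mem_filter] at hmem0
      obtain ⟨-, us', hp, he, hlt⟩ := hmem0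
      have hmono := G.distSet_applyAll_mono {w} v hp
      have hmono' := G.distSet_applyAll_mono {w} v (List.prefix_append us [u])
      simp only [WGraph.distSet_singleton] at hmono hmono'
      have heq : (G.applyAll us).dist v w = l :=
        le_antisymm (hmono'.trans hl.ge) (he ▸ hmono)
      have hltu : (G.applyAll us).distSet v {w} < (G.applyAll us).cap S d v := by
        rw [WGraph.distSet_singleton, heq, ← he]
        exact hlt.trans_le (G.cap_le_cap_applyAll S d v hp)
      have hs := hT.scans_repair_of_eq (u := u) ((G.applyAll us).isRadius_cap S d)
        (((G.applyAll us).apply u).cap S d) hltu (by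
          rw [← WGraph.applyAll_concat, WGraph.distSet_singleton, WGraph.distSet_singleton, heq,
            hl])
      rw [← hstep] at hs
      simp only [(hT.level_ne_top_iff v).2 hltu, if_false] at ih
      omega
    · have := Finset.card_lt_card (Finset.ssubset_iff_of_subset hsub |>.2 ⟨l, hmem, hmem0⟩)
      omega

open Classical in
/-- The number of times, up to the end of the updates, at which `w` is within distance `l`. -/
noncomputable def timesWithin (G : WGraph n) (us : List (Update n)) (v : Fin n) (l : ℕ)
    (w : Fin n) : ℕ :=
  ((Finset.range (us.length + 1)).filter
    fun t => (G.applyAll (us.take t)).dist v w ≤ l).card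

open Classical in
theorem totalScans_run_le (d : ℕ) (A S : Finset (Fin n)) (G : WGraph n) (us : List (Update n))
    (v : Fin n) :
    (run d A S G us).totalScans A v ≤ 2 * ∑ l ∈ Finset.range (d + 1),
      (A.filter fun w => ∀ a ∈ S, timesWithin G us v l a < timesWithin G us v l w).card := by
  have h1 : (run d A S G us).totalScans A v ≤ ∑ w ∈ A, 2 * (levels d S G us w v).card :=
    Finset.sum_le_sum fun w hw => (Nat.le_add_right _ _).trans (scans_add_le d A S G us hw v)
  refine h1.trans ?_
  rw [← Finset.mul_sum]
  refine Nat.mul_le_mul_left 2 ?_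
  refine (Finset.sum_card_bipartiteAbove_eq_sum_card_bipartiteBelow (s := Finset.range (d + 1))
    (t := A) fun (l : ℕ) w => ∃ us', us' <+: us ∧ (G.applyAll us').dist v w = l ∧
      (G.applyAll us').dist v w < (G.applyAll us').cap S d v).ge.trans ?_
  refine Finset.sum_le_sum fun l _ => Finset.card_le_card fun w => ?_
  simp only [Finset.mem_filter, Finset.bipartiteAbove]
  rintro ⟨hw, us', hp, he, hlt⟩
  refine ⟨hw, fun a ha => ?_⟩
  have htake := List.prefix_iff_eq_take.1 hp
  have hlen := hp.length_le
  have hmono : ∀ (x : Fin n) {s t : ℕ}, s ≤ t →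
      (G.applyAll (us.take s)).dist v x ≤ (G.applyAll (us.take t)).dist v x := by
    intro x s t hst
    have := G.distSet_applyAll_mono {x} v (List.take_prefix_take_left (l := us) hst)
    simpa only [WGraph.distSet_singleton] using this
  have hda : (l : ℕ∞) < (G.applyAll us').dist v a := by
    rw [← he]
    exact hlt.trans_le ((min_le_right _ _).trans (iInf₂_le a ha))
  have hup : timesWithin G us v l a ≤ us'.length := by
    rw [← Finset.card_range us'.length]
    refine Finset.card_le_card fun t ht => ?_
    simp only [Finset.mem_filter, Finset.mem_range] at ht ⊢
    by_contra! hge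
    have := hmono a hge
    rw [← htake] at this
    exact absurd (hda.trans_le this) (not_lt_of_ge ht.2)
  have hlow : us'.length + 1 ≤ timesWithin G us v l w := by
    rw [← Finset.card_range (us'.length + 1)]
    refine Finset.card_le_card fun t ht => ?_
    simp only [Finset.mem_filter, Finset.mem_range] at ht ⊢
    refine ⟨by omega, ?_⟩
    have := hmono w (Nat.lt_succ_iff.1 ht)
    rw [← htake, he] at this
    exact this
  omega

end LevelData

section SampleProb

theorem sampleProb_pos {n : ℕ} (hn : 0 < n) (k : ℕ) (ρ : ℝ) (i : ℕ) : 0 < sampleProb n k ρ i :=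
  lt_max_of_lt_left (Real.rpow_pos_of_pos (by exact_mod_cast hn) _)

theorem sampleProb_eq_rpow {n : ℕ} (hn : 0 < n) (k : ℕ) (ρ : ℝ) (i : ℕ) :
    sampleProb n k ρ i = (n : ℝ) ^ (-min ((2 : ℝ) ^ i * (1 / ((2 : ℝ) ^ k - 1))) ρ) := by
  have h1 : (1 : ℝ) ≤ n := by exact_mod_cast hn
  have hmono : Monotone fun x : ℝ => (n : ℝ) ^ x := fun x y h =>
    Real.rpow_le_rpow_of_exponent_le h1 h
  rw [sampleProb, ← max_neg_neg]
  exact (hmono.map_max).symm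

theorem one_le_sum_exponents {k : ℕ} (hk : 1 ≤ k) {ρ : ℝ} (hρ : 0 < ρ) :
    1 ≤ ∑ j ∈ Finset.range (numLevels k ρ), min ((2 : ℝ) ^ j * (1 / ((2 : ℝ) ^ k - 1))) ρ := by
  have h2 : (0 : ℝ) < 2 ^ k - 1 := sub_pos.2 (one_lt_pow₀ one_lt_two (by omega))
  have hnn : ∀ j : ℕ, 0 ≤ min ((2 : ℝ) ^ j * (1 / ((2 : ℝ) ^ k - 1))) ρ := fun j =>
    le_min (by positivity) hρ.le
  by_cases h : ∀ j < k, (2 : ℝ) ^ j * (1 / ((2 : ℝ) ^ k - 1)) ≤ ρ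
  · calc (1 : ℝ) = ∑ j ∈ Finset.range k, (2 : ℝ) ^ j * (1 / ((2 : ℝ) ^ k - 1)) := by
          rw [← Finset.sum_mul, geom_sum_eq (by norm_num)]
          field_simp
          norm_num
      _ = ∑ j ∈ Finset.range k, min ((2 : ℝ) ^ j * (1 / ((2 : ℝ) ^ k - 1))) ρ :=
          Finset.sum_congr rfl fun j hj => (min_eq_left (h j (Finset.mem_range.1 hj))).symm
      _ ≤ _ := Finset.sum_le_sum_of_subset_of_nonneg
          (Finset.range_mono (by unfold numLevels; omega)) fun j _ _ => hnn j
  · push Not at h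
    obtain ⟨i, hi, hlt⟩ := h
    calc (1 : ℝ) ≤ (⌈1 / ρ⌉₊ + 1) * ρ := by
          have := (div_le_iff₀ hρ).1 (Nat.le_ceil (1 / ρ))
          nlinarith
      _ = ∑ j ∈ Finset.Ico k (numLevels k ρ), ρ := by
          rw [Finset.sum_const, Nat.card_Ico, nsmul_eq_mul, numLevels,
            show k + ⌈1 / ρ⌉₊ + 1 - k = ⌈1 / ρ⌉₊ + 1 by omega]
          push_cast
          rfl
      _ = ∑ j ∈ Finset.Ico k (numLevels k ρ),
          min ((2 : ℝ) ^ j * (1 / ((2 : ℝ) ^ k - 1))) ρ := by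
          refine Finset.sum_congr rfl fun j hj => (min_eq_right (hlt.le.trans ?_)).symm
          gcongr
          · norm_num
          · exact hi.le.trans (Finset.mem_Ico.1 hj).1
      _ ≤ _ := Finset.sum_le_sum_of_subset_of_nonneg (fun j hj => by
          simpa using (Finset.mem_Ico.1 hj).2) fun j _ _ => hnn j

theorem mul_prod_sampleProb_le_one {n : ℕ} (hn : 0 < n) {k : ℕ} (hk : 1 ≤ k) {ρ : ℝ}
    (hρ : 0 < ρ) :
    (n : ℝ) * ∏ j ∈ Finset.range (numLevels k ρ), sampleProb n k ρ j ≤ 1 := by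
  have hn0 : (0 : ℝ) < n := by exact_mod_cast hn
  have h1 : (1 : ℝ) ≤ n := by exact_mod_cast hn
  simp only [sampleProb_eq_rpow hn]
  rw [← Real.rpow_sum_of_pos hn0, Finset.sum_neg_distrib]
  calc (n : ℝ) * _ ≤ n * (n : ℝ) ^ (-1 : ℝ) := by
        gcongr
        exact one_le_sum_exponents hk hρ
    _ = 1 := by rw [Real.rpow_neg_one, mul_inv_cancel₀ hn0.ne']

end SampleProb

section Sampling

variable {Ω : Type*} {n : ℕ} {coin : ℕ → Fin n → Set Ω} {L i : ℕ}

theorem mem_hierarchy (hi : i = 0 ∨ i < L) (ω : Ω) (v : Fin n) :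
    v ∈ hierarchy L coin ω i ↔ ∀ j < i, ω ∈ coin j v := by
  induction i with
  | zero => simp [hierarchy]
  | succ i ih =>
    have hL : i + 1 < L := by omega
    simp only [hierarchy, if_pos hL, Finset.mem_filter, ih (.inr (by omega)), Nat.lt_succ_iff_lt_or_eq]
    constructor
    · rintro ⟨h1, h2⟩ j (hj | rfl)
      exacts [h1 j hj, h2]
    · exact fun h => ⟨fun j hj => h j (.inl hj), h i (.inr rfl)⟩

theorem hierarchy_eq_empty (h : L ≤ i) (hi : i ≠ 0) (ω : Ω) : hierarchy L coin ω i = ∅ := by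
  obtain ⟨j, rfl⟩ := Nat.exists_eq_succ_of_ne_zero hi
  rw [hierarchy, if_neg (by omega)]

/-- The event that `w` reaches `A_i` and no vertex of `A_i` of larger rank survives the
`i`-th coin. -/
def noneSampledAbove {ι : Type*} [LT ι] (coin : ℕ → Fin n → Set Ω) (r : Fin n → ι) (i : ℕ)
    (w : Fin n) : Set Ω :=
  {ω | (∀ j < i, ω ∈ coin j w) ∧ ∀ a, r w < r a → (∀ j < i, ω ∈ coin j a) → ω ∉ coin i a}

theorem measurableSet_noneSampledAbove {ι : Type*} [Preorder ι] (m : MeasurableSpace Ω)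
    (r : Fin n → ι) (w : Fin n)
    (h : ∀ j a, j < i ∨ (j = i ∧ a ≠ w) → MeasurableSet[m] (coin j a)) :
    MeasurableSet[m] (noneSampledAbove coin r i w) := by
  have heq : noneSampledAbove coin r i w = (⋂ j, ⋂ (_ : j < i), coin j w) ∩
      ⋂ a, ⋂ (_ : r w < r a), ((⋂ j, ⋂ (_ : j < i), coin j a) ∩ coin i a)ᶜ := by
    ext ω
    simp [noneSampledAbove, imp_iff_not_or]
  rw [heq]
  refine .inter (.iInter fun j => .iInter fun hj => h j w (.inl hj)) ?_
  refine .iInter fun a => .iInter fun ha => .compl ?_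
  refine .inter (.iInter fun j => .iInter fun hj => h j a (.inl hj)) (h i a (.inr ⟨rfl, ?_⟩))
  rintro rfl
  exact lt_irrefl _ ha

variable [MeasurableSpace Ω] {μ : Measure Ω} {p : ℕ → ℝ≥0∞}

theorem measure_coin_inter_noneSampledAbove {ι : Type*} [Preorder ι]
    (hmeas : ∀ j v, j < L → MeasurableSet (coin j v))
    (hind : iIndepSet (fun p : Fin L × Fin n => coin p.1 p.2) μ)
    (hi : i < L) (r : Fin n → ι) (w : Fin n) :
    μ (coin i w ∩ noneSampledAbove coin r i w) =
      μ (coin i w) * μ (noneSampledAbove coin r i w) := by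
  let c : Fin L × Fin n := (⟨i, hi⟩, w)
  have hindep := hind.indep_generateFrom_of_disjoint
    (fun q : Fin L × Fin n => hmeas q.1 q.2 q.1.isLt) {c} {c}ᶜ disjoint_compl_right
  refine (Indep_iff _ _ _).1 hindep _ _ ?_ ?_
  · exact MeasurableSpace.measurableSet_generateFrom ⟨_, rfl, rfl⟩
  · refine measurableSet_noneSampledAbove _ r w fun j a hja => ?_
    have hj : j < L := by omega
    refine MeasurableSpace.measurableSet_generateFrom ⟨(⟨j, hj⟩, a), ?_, rfl⟩
    simp only [c, Set.mem_compl_iff, Set.mem_singleton_iff, Prod.mk.injEq, Fin.mk.injEq, not_and]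
    rintro rfl
    exact hja.elim (fun h => absurd h (lt_irrefl _)) fun h => h.2

/-- In expectation, `1 / p` vertices have no sampled vertex of larger rank. -/
theorem sum_measure_noneSampledAbove_le [IsProbabilityMeasure μ] {ι : Type*} [LinearOrder ι]
    (hmeas : ∀ j v, j < L → MeasurableSet (coin j v))
    (hind : iIndepSet (fun p : Fin L × Fin n => coin p.1 p.2) μ)
    (hp : ∀ j v, j < L → μ (coin j v) = p j)
    (hi : i < L) {r : Fin n → ι} (hr : Function.Injective r) :
    ∑ w, μ (noneSampledAbove coin r i w) ≤ (p i)⁻¹ := by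
  have hF : ∀ w, MeasurableSet (noneSampledAbove coin r i w) := fun w =>
    measurableSet_noneSampledAbove _ r w fun j a hja => hmeas j a (by omega)
  have hdisj : ∀ w w', r w < r w' → Disjoint (coin i w ∩ noneSampledAbove coin r i w)
      (coin i w' ∩ noneSampledAbove coin r i w') := fun w w' h =>
    Set.disjoint_left.2 fun ω h1 h2 => h1.2.2 w' h h2.2.1 h2.1
  have hsum : ∑ w, μ (coin i w ∩ noneSampledAbove coin r i w) ≤ 1 := by
    rw [← measure_univ (μ := μ)]
    refine sum_measure_le_measure_univ
      (fun w _ => ((hmeas i w hi).inter (hF w)).nullMeasurableSet) ?_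
    intro w _ w' _ hne
    rcases lt_or_gt_of_ne (hr.ne hne) with h | h
    · exact (hdisj w w' h).aedisjoint
    · exact (hdisj w' w h).symm.aedisjoint
  simp only [measure_coin_inter_noneSampledAbove hmeas hind hi, hp _ _ hi,
    ← Finset.mul_sum] at hsum
  rcases eq_or_ne (p i) 0 with h0 | h0
  · simp [h0]
  rcases isEmpty_or_nonempty (Fin n) with hn | ⟨⟨w⟩⟩
  · simp
  have hfin : p i ≠ ⊤ := hp i w hi ▸ measure_ne_top μ _
  rwa [ENNReal.le_inv_iff_mul_le, mul_comm]

theorem measure_forall_coin (hmeas : ∀ j v, j < L → MeasurableSet (coin j v))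
    (hind : iIndepSet (fun p : Fin L × Fin n => coin p.1 p.2) μ)
    (hp : ∀ j v, j < L → μ (coin j v) = p j) (hi : i ≤ L) (w : Fin n) :
    μ {ω | ∀ j < i, ω ∈ coin j w} = ∏ j ∈ Finset.range i, p j := by
  have hinj : Function.Injective fun j : Fin i => ((Fin.castLE hi j, w) : Fin L × Fin n) :=
    fun a b h => Fin.castLE_injective hi (Prod.ext_iff.1 h).1
  have h := (iIndepSet_iff_meas_biInter fun j : Fin i =>
    hmeas j w (j.2.trans_le hi)).1 (hind.precomp hinj) Finset.univ
  have heq : {ω | ∀ j < i, ω ∈ coin j w} =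
      ⋂ j ∈ (Finset.univ : Finset (Fin i)), coin j w := by
    ext ω
    simp [Fin.forall_iff]
  rw [heq, h, ← Fin.prod_univ_eq_prod_range]
  exact Finset.prod_congr rfl fun j _ => hp _ _ (j.2.trans_le hi)

end Sampling

/-- The vertices of `A_i` whose rank exceeds that of all of `A_{i+1}` lie in random sets whose
expected size is at most `1 / q_i`. -/
theorem exists_events_sum_measure_le {Ω : Type*} [MeasurableSpace Ω] {μ : Measure Ω}
    [IsProbabilityMeasure μ] {n k i : ℕ} {ρ : ℝ} (hk : 1 ≤ k) (hρ : 0 < ρ) (hn : 0 < n)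
    {coin : ℕ → Fin n → Set Ω}
    (hmeas : ∀ j v, j < numLevels k ρ → MeasurableSet (coin j v))
    (hind : iIndepSet (fun p : Fin (numLevels k ρ) × Fin n => coin p.1 p.2) μ)
    (hp : ∀ j v, j < numLevels k ρ → μ (coin j v) = ENNReal.ofReal (sampleProb n k ρ j))
    (hi : i ≤ numLevels k ρ) (f : Fin n → ℕ) :
    ∃ F : Fin n → Set Ω, (∀ w, MeasurableSet (F w)) ∧
      (∀ ω, ∀ w ∈ hierarchy (numLevels k ρ) coin ω i,
        (∀ a ∈ hierarchy (numLevels k ρ) coin ω (i + 1), f a < f w) → ω ∈ F w) ∧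
      ∑ w, μ (F w) ≤ (ENNReal.ofReal (sampleProb n k ρ i))⁻¹ := by
  rcases hi.eq_or_lt with rfl | hi
  · refine ⟨fun _ => ∅, by simp, fun ω w hw => ?_, by simp⟩
    rw [hierarchy_eq_empty le_rfl (by unfold numLevels; omega)] at hw
    simp at hw
  have hmem := fun ω v => mem_hierarchy (coin := coin) (.inr hi) ω v
  by_cases hi' : i + 1 < numLevels k ρ
  · let r : Fin n → ℕ ×ₗ Fin n := fun w => toLex (f w, w)
    have hr : Function.Injective r := fun a b h => (Prod.ext_iff.1 (toLex.injective h)).2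
    refine ⟨noneSampledAbove coin r i, fun w => ?_, fun ω w hw h => ?_,
      sum_measure_noneSampledAbove_le hmeas hind hp hi hr⟩
    · exact measurableSet_noneSampledAbove _ r w fun j a hja => hmeas j a (by omega)
    · refine ⟨(hmem ω w).1 hw, fun a hra ha hc => ?_⟩
      have hlt : f a < f w := by
        refine h a ((mem_hierarchy (.inr hi') ω a).2 fun j hj => ?_)
        rcases Nat.lt_succ_iff_lt_or_eq.1 hj with hj | rfl
        exacts [ha j hj, hc]
      rcases Prod.Lex.toLex_lt_toLex.1 hra with h' | h'
      · exact lt_asymm h' hlt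
      · exact hlt.ne' h'.1
  · refine ⟨fun w => {ω | ∀ j < i, ω ∈ coin j w}, fun w => ?_, fun ω w hw _ => (hmem ω w).1 hw, ?_⟩
    · have heq : {ω | ∀ j < i, ω ∈ coin j w} = ⋂ j, ⋂ (_ : j < i), coin j w := by
        ext ω; simp
      change MeasurableSet {ω | ∀ j < i, ω ∈ coin j w}
      rw [heq]
      exact .iInter fun j => .iInter fun hj => hmeas j w (hj.trans hi)
    · have hL : numLevels k ρ = i + 1 := by omega
      simp only [measure_forall_coin hmeas hind hp hi.le]
      have hpos := fun j => sampleProb_pos hn k ρ j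
      have h1 := mul_prod_sampleProb_le_one hn hk hρ
      rw [hL, Finset.prod_range_succ, ← mul_assoc] at h1
      rw [ENNReal.le_inv_iff_mul_le, ← ENNReal.ofReal_prod_of_nonneg fun j _ => (hpos j).le,
        Finset.sum_const, Finset.card_univ, Fintype.card_fin, nsmul_eq_mul,
        ← ENNReal.ofReal_natCast, ← ENNReal.ofReal_mul (by positivity),
        ← ENNReal.ofReal_mul (mul_nonneg (by positivity)
          (Finset.prod_nonneg fun j _ => (hpos j).le))]
      exact ENNReal.ofReal_le_one.2 h1

open Classical in
theorem lintegral_le_of_le_sum_card {Ω : Type*} [MeasurableSpace Ω] {μ : Measure Ω} {n m : ℕ}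
    {F : ℕ → Fin n → Set Ω} (hF : ∀ l w, MeasurableSet (F l w)) {c : ℝ≥0∞}
    (hc : ∀ l, ∑ w, μ (F l w) ≤ c) {X : Ω → ℕ}
    (hX : ∀ ω, X ω ≤ 2 * ∑ l ∈ Finset.range m, (Finset.univ.filter fun w => ω ∈ F l w).card) :
    ∫⁻ ω, (X ω : ℝ≥0∞) ∂μ ≤ 2 * (m * c) := by
  calc ∫⁻ ω, (X ω : ℝ≥0∞) ∂μ
      ≤ ∫⁻ ω, 2 * ∑ l ∈ Finset.range m, ∑ w, (F l w).indicator 1 ω ∂μ := by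
        refine lintegral_mono fun ω => ?_
        refine (Nat.cast_le.2 (hX ω)).trans_eq ?_
        push_cast [Finset.card_filter]
        simp [Set.indicator_apply]
    _ = 2 * ∑ l ∈ Finset.range m, ∑ w, μ (F l w) := by
        have hm : ∀ l w, Measurable ((F l w).indicator (1 : Ω → ℝ≥0∞)) := fun l w =>
          measurable_one.indicator (hF l w)
        rw [lintegral_const_mul _ (Finset.measurable_fun_sum _ fun l _ =>
            Finset.measurable_fun_sum _ fun w _ => hm l w),
          lintegral_finsetSum _ fun l _ => Finset.measurable_fun_sum _ fun w _ => hm l w]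
        refine congrArg _ (Finset.sum_congr rfl fun l _ => ?_)
        rw [lintegral_finsetSum _ fun w _ => hm l w]
        exact Finset.sum_congr rfl fun w _ => lintegral_indicator_one (hF l w)
    _ ≤ 2 * ∑ l ∈ Finset.range m, c := by gcongr; exact hc _
    _ = _ := by simp

end DecrementalClusters

open DecrementalClusters
theorem mainTheorem11 :
    ∃ C : ℝ, 0 < C ∧
      ∀ (n k d : ℕ) (ρ : ℝ), 1 ≤ k → 1 ≤ d → 0 < ρ →
      ∀ (G : WGraph n) (us : List (Update n))
        (Ω : Type*) [MeasurableSpace Ω] (μ : Measure Ω) [IsProbabilityMeasure μ]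
        (coin : ℕ → Fin n → Set Ω),
        (∀ j v, j < numLevels k ρ → MeasurableSet (coin j v)) →
        iIndepSet (fun p : Fin (numLevels k ρ) × Fin n => coin p.1 p.2) μ →
        (∀ j v, j < numLevels k ρ → μ (coin j v) = ENNReal.ofReal (sampleProb n k ρ j)) →
        ∀ i ≤ numLevels k ρ,
          -- after every update, the clusters up to depth `d` and their distances are correct
          (∀ ω, ∀ t ≤ us.length,
            ∀ w ∈ hierarchy (numLevels k ρ) coin ω i \ hierarchy (numLevels k ρ) coin ω (i + 1),
              let Gt := G.applyAll (us.take t)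
              let Ct := Gt.boundedCluster (hierarchy (numLevels k ρ) coin ω (i + 1)) d w
              let Tt := (LevelData.run d (hierarchy (numLevels k ρ) coin ω i)
                (hierarchy (numLevels k ρ) coin ω (i + 1)) G (us.take t)).clusterTree w
              {v | Tt.level v ≠ ⊤} = Ct ∧ ∀ v ∈ Ct, Tt.level v = Gt.dist v w) ∧
          -- the expected number of scans at every vertex is `O(d / q_i)`
          ∀ v : Fin n,
            ∫⁻ ω, (((LevelData.run d (hierarchy (numLevels k ρ) coin ω i)
                (hierarchy (numLevels k ρ) coin ω (i + 1)) G us).totalScans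
                (hierarchy (numLevels k ρ) coin ω i) v : ℕ) : ℝ≥0∞) ∂μ ≤
              ENNReal.ofReal (C * d / sampleProb n k ρ i) := by
  classical
  refine ⟨4, by norm_num, ?_⟩
  intro n k d ρ hk hd hρ G us Ω _ μ _ coin hmeas hind hp i hi
  refine ⟨fun ω t _ w hw => LevelData.clusterTree_run _ _ _ _ _ (Finset.mem_sdiff.1 hw).1,
    fun v => ?_⟩
  have hq := sampleProb_pos v.pos k ρ i
  choose F hF hmem hsum using fun l : ℕ =>
    exists_events_sum_measure_le hk hρ v.pos hmeas hind hp hi (LevelData.timesWithin G us v l)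
  refine (lintegral_le_of_le_sum_card (m := d + 1) hF hsum fun ω => ?_).trans ?_
  · refine (LevelData.totalScans_run_le ..).trans (Nat.mul_le_mul_left 2 ?_)
    refine Finset.sum_le_sum fun l _ => Finset.card_le_card fun w hw => ?_
    rw [Finset.mem_filter] at hw
    exact Finset.mem_filter.2 ⟨Finset.mem_univ w, hmem l ω w hw.1 hw.2⟩
  · have hd' : (1 : ℝ) ≤ d := by exact_mod_cast hd
    rw [← ENNReal.ofReal_inv_of_pos hq, ← ENNReal.ofReal_natCast, ← ENNReal.ofReal_ofNat 2,
      ← ENNReal.ofReal_mul (by positivity), ← ENNReal.ofReal_mul (by norm_num)]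
    refine ENNReal.ofReal_le_ofReal ?_
    rw [← mul_assoc, div_eq_mul_inv]
    refine mul_le_mul_of_nonneg_right ?_ (inv_nonneg.2 hq.le)
    push_cast
    linarith
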